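/- A crossed-module $\mathbb{G}=[\partial\colon G_2\to G_1]$ consists of groups $G_2,G_1$, a homomorphism $\partial$ and a right action $(\beta,a)\mapsto\beta^a$ of $G_1$ on the group $G_2$ by automorphisms, such that $\beta^{\partial\alpha}=\alpha^{-1}\beta\alpha$ and $\partial(\beta^a)=a^{-1}\,\partial(\beta)\,a$ for all $\alpha,\beta\in G_2$, $a\in G_1$. A morphism is a pair of group homomorphisms commuting with the maps $\partial$ and respecting the actions. Put $\pi_1\mathbb{G}=G_1/\partial(G_2)$ and $\pi_2\mathbb{G}=\ker\partial$; the action of $G_1$ on $G_2$ induces an action of $\pi_1\mathbb{G}$ on the abelian group $\pi_2\mathbb{G}$. An equivalence is a morphism inducing isomorphisms on $\pi_1$ and $\pi_2$, and $\mathrm{Ho}(\mathbf{XMod})$ is the category obtained from the category $\mathbf{XMod}$ of crossed-modules by formally inverting all equivalences. A group $\Gamma$ is regarded as the crossed-module $[1\to\Gamma]$. Proposition 13.7. Let $\mathbb{G}=[G_2\to G_1]$ be a crossed-module, and suppose that the natural map $p\colon\mathbb{G}\to\pi_1\mathbb{G}=[1\to\pi_1\mathbb{G}]$, viewed in $\mathrm{Ho}(\mathbf{XMod})$,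 admits a section, i.e. there is a morphism $s\colon\pi_1\mathbb{G}\to\mathbb{G}$ in $\mathrm{Ho}(\mathbf{XMod})$ with $p\circ s=\mathrm{id}$. Then $\mathbb{G}$ is split: it is isomorphic in $\mathrm{Ho}(\mathbf{XMod})$ to the crossed-module $[\pi_2\mathbb{G}\to\pi_1\mathbb{G}]$ with trivial boundary map and the induced action of $\pi_1\mathbb{G}$ on $\pi_2\mathbb{G}$. -/

import Mathlib

open CategoryTheory

universe u

/-- A crossed-module `[∂ : G₂ → G₁]`: groups `G₂` and `G₁`, a homomorphism `∂`, and a right action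
`act β a = β ^ a` of the group `G₁` on the group `G₂` by automorphisms, such that
`β ^ (∂ α) = α⁻¹ β α` and `∂ (β ^ a) = a⁻¹ (∂ β) a`. -/
structure XMod where
  G₂ : Type u
  G₁ : Type u
  [group₂ : Group G₂]
  [group₁ : Group G₁]
  bd : G₂ →* G₁
  act : G₂ → G₁ → G₂
  act_one : ∀ β : G₂, act β 1 = β
  act_mul : ∀ (β : G₂) (a b : G₁), act β (a * b) = act (act β a) b
  mul_act : ∀ (β γ : G₂) (a : G₁), act (β * γ) a = act β a * act γ a
  act_bd : ∀ α β : G₂, act β (bd α) = α⁻¹ * β * α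
  bd_act : ∀ (β : G₂) (a : G₁), bd (act β a) = a⁻¹ * bd β * a

namespace XMod

attribute [instance] XMod.group₂ XMod.group₁

/-- A (strict) morphism of crossed-modules: a pair of group homomorphisms which commutes with the
boundary maps and respects the actions. -/
@[ext]
structure Hom (H G : XMod.{u}) where
  f₂ : H.G₂ →* G.G₂
  f₁ : H.G₁ →* G.G₁
  comm : ∀ β : H.G₂, G.bd (f₂ β) = f₁ (H.bd β)
  equivariant : ∀ (β : H.G₂) (a : H.G₁), f₂ (H.act β a) = G.act (f₂ β) (f₁ a)

/-- The category `XMod` of crossed-modules and strict morphisms. -/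
instance : Category XMod.{u} where
  Hom := Hom
  id G :=
    { f₂ := MonoidHom.id _
      f₁ := MonoidHom.id _
      comm := fun _ => rfl
      equivariant := fun _ _ => rfl }
  comp f g :=
    { f₂ := g.f₂.comp f.f₂
      f₁ := g.f₁.comp f.f₁
      comm := fun β => by simp [g.comm, f.comm]
      equivariant := fun β a => by simp [g.equivariant, f.equivariant] }

/-- The image of the boundary map is a normal subgroup of `G₁`. -/
instance normal_range (G : XMod.{u}) : G.bd.range.Normal where
  conj_mem := by
    rintro _ ⟨β, rfl⟩ g
    exact ⟨G.act β g⁻¹, by simp [G.bd_act]⟩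

/-- `π₁ G`, the cokernel of the boundary map. -/
abbrev π₁ (G : XMod.{u}) : Type u := G.G₁ ⧸ G.bd.range

/-- `π₂ G`, the kernel of the boundary map. -/
abbrev π₂ (G : XMod.{u}) : Type u := G.bd.ker

/-- The map induced on `π₁` by a morphism of crossed-modules. -/
def π₁Map {H G : XMod.{u}} (f : H ⟶ G) : H.π₁ →* G.π₁ :=
  QuotientGroup.map H.bd.range G.bd.range f.f₁ (by
    rintro _ ⟨β, rfl⟩
    exact ⟨f.f₂ β, f.comm β⟩)

/-- The map induced on `π₂` by a morphism of crossed-modules. -/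
def π₂Map {H G : XMod.{u}} (f : H ⟶ G) : H.π₂ →* G.π₂ :=
  (f.f₂.comp H.bd.ker.subtype).codRestrict G.bd.ker (fun β => by
    have hβ : H.bd β = 1 := β.2
    simp [MonoidHom.mem_ker, f.comm, hβ])

/-- The equivalences of crossed-modules: the morphisms inducing isomorphisms on `π₁` and `π₂`. -/
def equivalences : MorphismProperty XMod.{u} := fun _ _ f =>
  Function.Bijective (π₁Map f) ∧ Function.Bijective (π₂Map f)

/-- The homotopy category `Ho(XMod)`, obtained from `XMod` by formally inverting all
equivalences. -/
abbrev Ho : Type (u + 1) := (equivalences.{u}).Localization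

/-- The localization functor from `XMod` to `Ho(XMod)`. -/
abbrev toHo : XMod.{u} ⥤ Ho.{u} := (equivalences.{u}).Q

/-- A group `Γ` viewed as the crossed-module `[1 → Γ]`. -/
def ofGroup (Γ : Type u) [Group Γ] : XMod.{u} where
  G₂ := PUnit
  G₁ := Γ
  bd := 1
  act := fun β _ => β
  act_one := fun _ => rfl
  act_mul := fun _ _ _ => rfl
  mul_act := fun _ _ _ => rfl
  act_bd := fun _ _ => rfl
  bd_act := fun _ _ => by simp

/-- The natural morphism of crossed-modules from `G` to `[1 → π₁ G]`. -/
def toπ₁ (G : XMod.{u}) : G ⟶ ofGroup G.π₁ :=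
  Hom.mk (G := ofGroup G.π₁) 1 (QuotientGroup.mk' G.bd.range)
    (fun β => ((QuotientGroup.eq_one_iff (N := G.bd.range) (G.bd β)).2 ⟨β, rfl⟩).symm)
    (fun _ _ => rfl)

/-- The action of `G₁` on `G₂` preserves `π₂ G`. -/
def actπ₂ (G : XMod.{u}) (β : G.π₂) (a : G.G₁) : G.π₂ :=
  ⟨G.act β a, by
    have hβ : G.bd β = 1 := β.2
    simp [MonoidHom.mem_ker, G.bd_act, hβ]⟩

theorem π₂_central (G : XMod.{u}) (β : G.π₂) (α : G.G₂) : (β : G.G₂) * α = α * β := by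
  have hβ : G.bd β = 1 := β.2
  have h := G.act_bd (β : G.G₂) α
  rw [hβ, G.act_one] at h
  calc (β : G.G₂) * α = β * ((β : G.G₂)⁻¹ * α * β) := by rw [← h]
    _ = α * β := by group

/-- The induced right action of `π₁ G` on `π₂ G`; on the class of `a` it is the action of `a`. -/
def π₁Act (G : XMod.{u}) (β : G.π₂) : G.π₁ → G.π₂ :=
  Quotient.lift (G.actπ₂ β) (by
    intro a b hab
    obtain ⟨α, hα⟩ := QuotientGroup.leftRel_apply.1 hab
    obtain rfl : b = a * G.bd α := by rw [hα]; group
    apply Subtype.ext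
    change G.act β a = G.act β (a * G.bd α)
    rw [G.act_mul, G.act_bd, mul_assoc]
    have h := G.π₂_central (G.actπ₂ β a) α
    change G.act β a * α = α * G.act β a at h
    rw [h]; group)

/-- The crossed-module `[π₂ G → π₁ G]` with trivial boundary map and the induced action. -/
def trivialModel (G : XMod.{u}) : XMod.{u} where
  G₂ := G.π₂
  G₁ := G.π₁
  bd := 1
  act := G.π₁Act
  act_one := fun β => Subtype.ext (G.act_one β)
  act_mul := fun β a b => by
    induction a using QuotientGroup.induction_on with | H a => ?_
    induction b using QuotientGroup.induction_on with | H b => ?_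
    exact Subtype.ext (G.act_mul β a b)
  mul_act := fun β γ a => by
    induction a using QuotientGroup.induction_on with | H a => ?_
    exact Subtype.ext (G.mul_act β γ a)
  act_bd := fun α β => Subtype.ext (by
    change G.act β 1 = (α : G.G₂)⁻¹ * β * α
    rw [G.act_one, mul_assoc, G.π₂_central β α]; group)
  bd_act := fun β a => by simp

/-- A crossed-module `G` is split if it is isomorphic in `Ho(XMod)` to `[π₂ G → π₁ G]` with
trivial boundary map. -/
def IsSplit (G : XMod.{u}) : Prop :=
  Nonempty (toHo.obj G ≅ toHo.obj G.trivialModel)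

end XMod

/-! A strict splitting need not exist, so `π₁ G` is replaced by `[ker q → F]` with `q` a surjection
from a free group `F`. When `H.G₁` is free, homotopy classes of morphisms out of `H` send
equivalences to bijections (`homotopyClasses_isInvertedBy`), so this functor factors through `Ho`.
Applied to the section `s`, the factored functor carries the class of `q` to that of some `σ : [ker
q → F] ⟶ G` lying over `q` up to homotopy. Since homotopic maps to a group are equal, `σ` lies
strictly over `q` (`exists_strict_lift`).

Now `[ker q × π₂ G → F]` maps to `G` by `(r, x) ↦ σ(r) x` and to the trivial model by projection.
Both maps are equivalences, and this zigzag becomes the required isomorphism in `Ho`. -/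

namespace XMod

/-! ### Elementary identities for actions and morphisms. -/

section BasicLemmas

variable {H G : XMod.{u}}

@[simp]
theorem one_act (a : G.G₁) : G.act 1 a = 1 := by
  have h := G.mul_act 1 1 a
  rw [one_mul] at h
  exact left_eq_mul.1 h

theorem inv_act (β : G.G₂) (a : G.G₁) : G.act β⁻¹ a = (G.act β a)⁻¹ := by
  rw [eq_inv_iff_mul_eq_one, ← G.mul_act, inv_mul_cancel, one_act]

theorem act_act_inv (β : G.G₂) (a : G.G₁) : G.act (G.act β a) a⁻¹ = β := by
  rw [← G.act_mul, mul_inv_cancel, G.act_one]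

theorem act_inv_act (β : G.G₂) (a : G.G₁) : G.act (G.act β a⁻¹) a = β := by
  rw [← G.act_mul, inv_mul_cancel, G.act_one]

@[ext]
theorem hom_ext {f g : H ⟶ G} (h₂ : ∀ β, f.f₂ β = g.f₂ β) (h₁ : ∀ a, f.f₁ a = g.f₁ a) : f = g :=
  Hom.ext (MonoidHom.ext h₂) (MonoidHom.ext h₁)

@[simp]
theorem comp_f₂ {K : XMod.{u}} (f : K ⟶ H) (g : H ⟶ G) (β : K.G₂) :
    (f ≫ g).f₂ β = g.f₂ (f.f₂ β) := rfl

@[simp]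
theorem comp_f₁ {K : XMod.{u}} (f : K ⟶ H) (g : H ⟶ G) (a : K.G₁) :
    (f ≫ g).f₁ a = g.f₁ (f.f₁ a) := rfl

end BasicLemmas

/-! ### Equivalences as fibre products, and strict lifting. -/

section Equivalences

variable {X Y : XMod.{u}} {w : X ⟶ Y}

/-- An equivalence exhibits `X.G₂` as the fibre product of `X.G₁` and `Y.G₂` over `Y.G₁`. -/
theorem existsUnique_of_equivalences (hw : equivalences w) (a : X.G₁) (b : Y.G₂)
    (hab : w.f₁ a = Y.bd b) : ∃! α : X.G₂, X.bd α = a ∧ w.f₂ α = b := by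
  obtain ⟨h₁, h₂⟩ := hw
  have ha : (QuotientGroup.mk a : X.π₁) = 1 := by
    apply h₁.1
    rw [map_one]
    exact (QuotientGroup.eq_one_iff (N := Y.bd.range) (w.f₁ a)).2 ⟨b, hab.symm⟩
  obtain ⟨α, rfl⟩ := (QuotientGroup.eq_one_iff (N := X.bd.range) a).1 ha
  -- `α` has the right boundary; its image misses `b` by an element of `π₂ Y`, which lifts to a
  -- correction `κ`.
  obtain ⟨κ, hκ⟩ := h₂.2 ⟨(w.f₂ α)⁻¹ * b, by
    rw [MonoidHom.mem_ker, map_mul, map_inv, w.comm, hab, inv_mul_cancel]⟩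
  have hκ' : w.f₂ κ = (w.f₂ α)⁻¹ * b := congrArg Subtype.val hκ
  have hκ₁ : X.bd κ = 1 := κ.2
  refine ⟨α * κ, ⟨by rw [map_mul, hκ₁, mul_one], by rw [map_mul, hκ', mul_inv_cancel_left]⟩, ?_⟩
  rintro α' ⟨h, h'⟩
  have hker : α⁻¹ * α' ∈ X.bd.ker := by
    rw [MonoidHom.mem_ker, map_mul, map_inv, h, inv_mul_cancel]
  have : (⟨α⁻¹ * α', hker⟩ : X.π₂) = κ := by
    apply h₂.1
    apply Subtype.ext
    change w.f₂ (α⁻¹ * α') = w.f₂ κ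
    rw [map_mul, map_inv, h', hκ']
  have h3 : α⁻¹ * α' = κ := congrArg Subtype.val this
  rw [← h3, mul_inv_cancel_left]

/-- The uniqueness half of the fibre product property; identities in `X.G₂` are checked below after
applying `X.bd` and `w.f₂`. -/
theorem eq_of_equivalences (hw : equivalences w) {α α' : X.G₂} (h : X.bd α = X.bd α')
    (h' : w.f₂ α = w.f₂ α') : α = α' :=
  (existsUnique_of_equivalences hw (X.bd α) (w.f₂ α) (w.comm α).symm).unique ⟨rfl, rfl⟩
    ⟨h.symm, h'.symm⟩

theorem exists_mul_bd_of_equivalences (hw : equivalences w) (b : Y.G₁) :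
    ∃ (a : X.G₁) (β : Y.G₂), w.f₁ a = b * Y.bd β := by
  obtain ⟨a, ha⟩ := hw.1.2 (QuotientGroup.mk b)
  induction a using QuotientGroup.induction_on with | H a => ?_
  obtain ⟨β, hβ⟩ := QuotientGroup.eq.1 ha.symm
  exact ⟨a, β, by rw [hβ, mul_inv_cancel_left]⟩

/-- A morphism whose component on `G₁` lifts through an equivalence lifts through it. -/
theorem exists_lift_of_equivalences (hw : equivalences w) {K : XMod.{u}} (g : K ⟶ Y)
    (k : K.G₁ →* X.G₁) (hk : ∀ x, w.f₁ (k x) = g.f₁ x) : ∃ f : K ⟶ X, f ≫ w = g := by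
  have key (r : K.G₂) : ∃ α : X.G₂, X.bd α = k (K.bd r) ∧ w.f₂ α = g.f₂ r :=
    (existsUnique_of_equivalences hw _ _ (by rw [hk, g.comm])).exists
  choose l hl₁ hl₂ using key
  refine ⟨Hom.mk (MonoidHom.mk' l fun r r' => ?_) k hl₁ fun r x => ?_, ?_⟩
  · apply eq_of_equivalences hw
    · simp only [map_mul, hl₁]
    · simp only [map_mul, hl₂]
  · apply eq_of_equivalences hw
    · simp only [MonoidHom.mk'_apply, X.bd_act, hl₁, K.bd_act, map_mul, map_inv]
    · simp only [MonoidHom.mk'_apply, w.equivariant, hl₂, hk, g.equivariant]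
  · ext
    · exact hl₂ _
    · exact hk _

end Equivalences

/-! ### Derivations, homotopy classes and their descent to `Ho`. -/

section Homotopy

variable {H G : XMod.{u}}

/-- A derivation along a morphism `f : H ⟶ G`: a crossed homomorphism from `H.G₁` to `G.G₂`. -/
structure Derivation (f : H ⟶ G) where
  toFun : H.G₁ → G.G₂
  map_mul : ∀ x y, toFun (x * y) = G.act (toFun x) (f.f₁ y) * toFun y

namespace Derivation

variable {f : H ⟶ G} (θ : Derivation f)

theorem map_one : θ.toFun 1 = 1 := by
  have h := θ.map_mul 1 1
  rw [mul_one, _root_.map_one, G.act_one] at h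
  exact left_eq_mul.1 h

theorem act_map_inv (x : H.G₁) : G.act (θ.toFun x⁻¹) (f.f₁ x) = (θ.toFun x)⁻¹ := by
  rw [eq_inv_iff_mul_eq_one, ← θ.map_mul, inv_mul_cancel, θ.map_one]

/-- The deformation of a morphism `f` along a derivation. -/
def twist : H ⟶ G :=
  Hom.mk
    (MonoidHom.mk' (fun r => f.f₂ r * θ.toFun (H.bd r)) fun r r' => by
      rw [_root_.map_mul, _root_.map_mul, θ.map_mul, ← f.comm, G.act_bd]
      group)
    (MonoidHom.mk' (fun x => f.f₁ x * G.bd (θ.toFun x)) fun x y => by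
      rw [θ.map_mul, _root_.map_mul, _root_.map_mul, G.bd_act]
      group)
    (fun r => by simp [f.comm])
    (fun r x => by
      simp only [MonoidHom.mk'_apply]
      -- Moving the boundary to the right of `f.f₁ x` lets `act_bd` turn its action into
      -- conjugation.
      have h : f.f₁ (H.bd r * x) = f.f₁ x * G.bd (G.act (f.f₂ r) (f.f₁ x)) := by
        rw [G.bd_act, f.comm, _root_.map_mul]
        group
      rw [H.bd_act, mul_assoc, θ.map_mul, θ.map_mul, h, G.act_mul, θ.act_map_inv, G.act_bd,
        f.equivariant, G.act_mul, G.mul_act, G.act_bd]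
      group)

@[simp]
theorem twist_f₂ (r : H.G₂) : θ.twist.f₂ r = f.f₂ r * θ.toFun (H.bd r) := rfl

@[simp]
theorem twist_f₁ (x : H.G₁) : θ.twist.f₁ x = f.f₁ x * G.bd (θ.toFun x) := rfl

end Derivation

/-- Two morphisms of crossed-modules are homotopic if a derivation deforms one into the other. -/
def Homotopic (f g : H ⟶ G) : Prop := ∃ θ : Derivation f, θ.twist = g

theorem Homotopic.refl (f : H ⟶ G) : Homotopic f f :=
  ⟨⟨fun _ => 1, by simp⟩, by ext <;> simp⟩

theorem Homotopic.symm {f g : H ⟶ G} : Homotopic f g → Homotopic g f := by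
  rintro ⟨θ, rfl⟩
  refine ⟨⟨fun x => (θ.toFun x)⁻¹, fun x y => ?_⟩, ?_⟩
  · rw [θ.map_mul, θ.twist_f₁, G.act_mul, G.act_bd, inv_act]
    group
  · ext <;> simp

theorem Homotopic.trans {f g h : H ⟶ G} : Homotopic f g → Homotopic g h → Homotopic f h := by
  rintro ⟨θ, rfl⟩ ⟨η, rfl⟩
  refine ⟨⟨fun x => θ.toFun x * η.toFun x, fun x y => ?_⟩, ?_⟩
  · rw [θ.map_mul, η.map_mul, θ.twist_f₁, G.act_mul, G.act_bd, G.mul_act]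
    group
  · ext <;> simp [mul_assoc]

theorem Homotopic.comp_right {f g : H ⟶ G} {K : XMod.{u}} (w : G ⟶ K) :
    Homotopic f g → Homotopic (f ≫ w) (g ≫ w) := by
  rintro ⟨θ, rfl⟩
  refine ⟨⟨fun x => w.f₂ (θ.toFun x), fun x y => ?_⟩, ?_⟩
  · rw [θ.map_mul, map_mul, w.equivariant, comp_f₁]
  · ext <;> simp [w.comm]

/-- An equivalence reflects the homotopy relation. -/
theorem Homotopic.of_comp_equivalences {f g : H ⟶ G} {K : XMod.{u}} {w : G ⟶ K}
    (hw : equivalences w) : Homotopic (f ≫ w) (g ≫ w) → Homotopic f g := by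
  rintro ⟨θ, hθ⟩
  have h₁ (x : H.G₁) : w.f₁ (f.f₁ x) * K.bd (θ.toFun x) = w.f₁ (g.f₁ x) :=
    congrArg (fun k : H ⟶ K => k.f₁ x) hθ
  have h₂ (r : H.G₂) : w.f₂ (f.f₂ r) * θ.toFun (H.bd r) = w.f₂ (g.f₂ r) :=
    congrArg (fun k : H ⟶ K => k.f₂ r) hθ
  have key (x : H.G₁) : ∃ α : G.G₂, G.bd α = (f.f₁ x)⁻¹ * g.f₁ x ∧ w.f₂ α = θ.toFun x :=
    (existsUnique_of_equivalences hw _ _ (by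
      rw [map_mul, map_inv, ← h₁, inv_mul_cancel_left])).exists
  choose φ hφ₁ hφ₂ using key
  refine ⟨⟨φ, fun x y => ?_⟩, ?_⟩
  · apply eq_of_equivalences hw
    · rw [map_mul, G.bd_act, hφ₁, hφ₁, hφ₁, map_mul, map_mul]
      group
    · rw [map_mul, w.equivariant, hφ₂, hφ₂, hφ₂, θ.map_mul, comp_f₁]
  · ext r
    · apply eq_of_equivalences hw
      · simp [hφ₁, f.comm, g.comm]
      · simp [hφ₂, h₂]
    · simp [hφ₁]

/-- The left action of `G₁` on `G₂` associated to the right action. -/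
def leftAct (G : XMod.{u}) : G.G₁ →* MulAut G.G₂ :=
  MonoidHom.mk'
    (fun a =>
      { toFun := fun β => G.act β a⁻¹
        invFun := fun β => G.act β a
        left_inv := fun β => act_inv_act β a
        right_inv := fun β => act_act_inv β a
        map_mul' := fun β γ => G.mul_act β γ a⁻¹ })
    fun a b => by
      ext β
      change G.act β (a * b)⁻¹ = G.act (G.act β b⁻¹) a⁻¹
      rw [mul_inv_rev, G.act_mul]

theorem leftAct_apply (a : G.G₁) (β : G.G₂) : G.leftAct a β = G.act β a⁻¹ := rfl

/-- A derivation on a free group takes arbitrary prescribed values on the generators. -/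
theorem exists_derivation [IsFreeGroup H.G₁] (f : H ⟶ G)
    (t : IsFreeGroup.Generators H.G₁ → G.G₂) :
    ∃ θ : Derivation f, ∀ i, θ.toFun (IsFreeGroup.of i) = t i := by
  -- Derivations along `f` are lifts of `f.f₁` to the semidirect product, which freeness provides;
  -- the inverse converts between right and left actions.
  let L : H.G₁ →* G.G₂ ⋊[G.leftAct] G.G₁ := IsFreeGroup.lift fun i =>
    ⟨G.act (t i) (f.f₁ (IsFreeGroup.of i))⁻¹, f.f₁ (IsFreeGroup.of i)⟩
  have hL (x : H.G₁) : (L x).right = f.f₁ x := by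
    have : SemidirectProduct.rightHom.comp L = f.f₁ :=
      IsFreeGroup.ext_hom fun i => by simp [L]
    exact DFunLike.congr_fun this x
  refine ⟨⟨fun x => G.act (L x).left (f.f₁ x), fun x y => ?_⟩, fun i => ?_⟩
  · rw [map_mul, SemidirectProduct.mul_left, leftAct_apply, hL, map_mul, G.mul_act,
      ← G.act_mul, ← G.act_mul, inv_mul_cancel_left]
  · simp [L, act_inv_act]

/-- Morphisms from a crossed-module with `G₁` free lift through equivalences up to homotopy. -/
theorem exists_lift_homotopic [IsFreeGroup H.G₁] {X : XMod.{u}} {w : X ⟶ G}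
    (hw : equivalences w) (g : H ⟶ G) : ∃ f : H ⟶ X, Homotopic g (f ≫ w) := by
  -- The generators lift only up to boundaries of `t i`; twisting `g` by the derivation with values
  -- `t` absorbs them.
  choose a t hat using fun i : IsFreeGroup.Generators H.G₁ =>
    exists_mul_bd_of_equivalences hw (g.f₁ (IsFreeGroup.of i))
  obtain ⟨θ, hθ⟩ := exists_derivation g t
  have hk : w.f₁.comp (IsFreeGroup.lift a) = θ.twist.f₁ :=
    IsFreeGroup.ext_hom fun i => by simp [hat, hθ]
  obtain ⟨f, hf⟩ :=
    exists_lift_of_equivalences hw θ.twist (IsFreeGroup.lift a) (DFunLike.congr_fun hk)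
  exact ⟨f, θ, hf.symm⟩

/-- The homotopy relation as a setoid. -/
def homotopySetoid (H G : XMod.{u}) : Setoid (H ⟶ G) :=
  ⟨Homotopic, Homotopic.refl, Homotopic.symm, Homotopic.trans⟩

/-- The functor sending a crossed-module `G` to the set of homotopy classes of morphisms
`H ⟶ G`. -/
def homotopyClasses (H : XMod.{u}) : XMod.{u} ⥤ Type u where
  obj G := Quotient (homotopySetoid H G)
  map w := TypeCat.ofHom (Quotient.map (· ≫ w) fun _ _ h => h.comp_right w)
  map_id G := by
    ext x
    induction x using Quotient.inductionOn
    simp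
  map_comp v w := by
    ext x
    induction x using Quotient.inductionOn with | h f => ?_
    exact congrArg (Quotient.mk _) (Category.assoc f v w).symm

/-- Injectivity is reflection of homotopies and holds for every `H`; only surjectivity uses
freeness. -/
theorem homotopyClasses_isInvertedBy (H : XMod.{u}) [IsFreeGroup H.G₁] :
    equivalences.IsInvertedBy (homotopyClasses H) := by
  intro X Y w hw
  rw [isIso_iff_bijective]
  constructor
  · intro x y
    induction x using Quotient.inductionOn
    induction y using Quotient.inductionOn
    intro h
    exact Quotient.sound (Homotopic.of_comp_equivalences hw (Quotient.exact h))
  · intro y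
    induction y using Quotient.inductionOn with | h g => ?_
    obtain ⟨f, hf⟩ := exists_lift_homotopic hw g
    exact ⟨Quotient.mk _ f, Quotient.sound hf.symm⟩

/-- Morphisms to a group, viewed as a crossed-module, are homotopic only if they are equal. -/
theorem Homotopic.eq_of_ofGroup {Γ : Type u} [Group Γ] {f g : H ⟶ ofGroup Γ}
    (h : Homotopic f g) : f = g := by
  obtain ⟨θ, rfl⟩ := h
  ext x
  · rfl
  · exact (mul_one (f.f₁ x)).symm

/-- A section in the homotopy category of a morphism to a group is represented, on a
crossed-module with `G₁` free, by a strict lift. -/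
theorem exists_strict_lift [IsFreeGroup H.G₁] {Γ : Type u} [Group Γ] (q : H ⟶ ofGroup Γ)
    (p : G ⟶ ofGroup Γ) (s : toHo.obj (ofGroup Γ) ⟶ toHo.obj G)
    (hs : s ≫ toHo.map p = 𝟙 _) : ∃ σ : H ⟶ G, σ ≫ p = q := by
  let T : Ho.{u} ⥤ Type u :=
    Localization.Construction.lift (homotopyClasses H) (homotopyClasses_isInvertedBy H)
  let y : (homotopyClasses H).obj G := T.map s (Quotient.mk (homotopySetoid H _) q)
  have hy : (homotopyClasses H).map p y = Quotient.mk (homotopySetoid H _) q := by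
    have h := congrArg T.map hs
    rw [T.map_comp, T.map_id] at h
    exact ConcreteCategory.congr_hom h (Quotient.mk (homotopySetoid H _) q)
  obtain ⟨σ, hσ⟩ := Quotient.exists_rep y
  rw [← hσ] at hy
  exact ⟨σ, Homotopic.eq_of_ofGroup (Quotient.exact hy)⟩

end Homotopy

/-! ### The zigzag from `G` to the trivial model. -/

section Splitting

/-- The crossed-module `[ker q → A]` of a group homomorphism `q` defined on `A`. -/
def ofKer {A Γ : Type u} [Group A] [Group Γ] (q : A →* Γ) : XMod.{u} where
  G₂ := q.ker
  G₁ := A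
  bd := q.ker.subtype
  act := fun r a => ⟨a⁻¹ * r * a, by
    have hr : q r = 1 := r.2
    simp [MonoidHom.mem_ker, hr]⟩
  act_one := fun r => Subtype.ext (by simp)
  act_mul := fun r a b => Subtype.ext (by simp [mul_assoc])
  mul_act := fun r r' a => Subtype.ext (by simp [mul_assoc])
  act_bd := fun r r' => rfl
  bd_act := fun r a => rfl

/-- The morphism from `[ker q → A]` to the target of `q`. -/
def ofKerMap {A Γ : Type u} [Group A] [Group Γ] (q : A →* Γ) : ofKer q ⟶ ofGroup Γ :=
  Hom.mk (H := ofKer q) (G := ofGroup Γ) 1 q (fun r => Eq.symm r.2) (fun _ _ => rfl)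

variable (G : XMod.{u}) {A : Type u} [Group A] (q : A →* G.π₁)

/-- The crossed-module `[ker q × π₂ G → A]`, where `q : A → π₁ G` and the boundary map vanishes on
`π₂ G`. -/
def kerProd : XMod.{u} where
  G₂ := (ofKer q).G₂ × G.π₂
  G₁ := A
  bd := (ofKer q).bd.comp (MonoidHom.fst _ _)
  act := fun β a => ((ofKer q).act β.1 a, G.trivialModel.act β.2 (q a))
  act_one := fun β => Prod.ext ((ofKer q).act_one _) (by
    rw [map_one]
    exact G.trivialModel.act_one _)
  act_mul := fun β a b => Prod.ext ((ofKer q).act_mul _ _ _) (by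
    rw [map_mul]
    exact G.trivialModel.act_mul _ _ _)
  mul_act := fun β γ a => Prod.ext ((ofKer q).mul_act _ _ _) (G.trivialModel.mul_act _ _ _)
  act_bd := fun α β => Prod.ext ((ofKer q).act_bd _ _) (by
    have h : q ((ofKer q).bd α.1) = 1 := α.1.2
    change G.trivialModel.act β.2 (q ((ofKer q).bd α.1)) = α.2⁻¹ * β.2 * α.2
    rw [h]
    exact G.trivialModel.act_bd α.2 β.2)
  bd_act := fun β a => (ofKer q).bd_act _ _

/-- The projection from `[ker q × π₂ G → A]` to `[π₂ G → π₁ G]`. -/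
def kerProdToTrivialModel : kerProd G q ⟶ G.trivialModel :=
  Hom.mk (H := kerProd G q) (G := G.trivialModel) (MonoidHom.snd _ _) q
    (fun β => Eq.symm β.1.2) (fun _ _ => rfl)

variable {G q}

theorem mk_f₁_of_comp_toπ₁ {σ : ofKer q ⟶ G} (hσ : σ ≫ G.toπ₁ = ofKerMap q) (a : A) :
    (QuotientGroup.mk (σ.f₁ a) : G.π₁) = q a :=
  congrArg (fun k : ofKer q ⟶ ofGroup G.π₁ => k.f₁ a) hσ

/-- The morphism from `[ker q × π₂ G → A]` to `G` induced by a lift `σ` of `q`. -/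
def kerProdDesc (σ : ofKer q ⟶ G) (hσ : σ ≫ G.toπ₁ = ofKerMap q) : kerProd G q ⟶ G :=
  Hom.mk (H := kerProd G q)
    (MonoidHom.mk' (fun β : (ofKer q).G₂ × G.π₂ => σ.f₂ β.1 * β.2)
      fun ⟨r, x⟩ ⟨r', x'⟩ => by
        change σ.f₂ (r * r') * ((x : G.G₂) * x') = σ.f₂ r * x * (σ.f₂ r' * x')
        -- Multiplicativity rests on `π₂ G` being central.
        rw [map_mul, mul_assoc, mul_assoc, ← mul_assoc (x : G.G₂), G.π₂_central x (σ.f₂ r'),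
          mul_assoc])
    σ.f₁
    (fun β => by
      have h : G.bd β.2 = 1 := β.2.2
      change G.bd (σ.f₂ β.1 * β.2) = σ.f₁ ((ofKer q).bd β.1)
      rw [map_mul, h, mul_one, σ.comm])
    (fun ⟨r, x⟩ a => by
      change σ.f₂ ((ofKer q).act r a) * (G.π₁Act x (q a) : G.π₂) = G.act (σ.f₂ r * x) (σ.f₁ a)
      rw [G.mul_act, σ.equivariant r a]
      exact congrArg (fun y => G.act (σ.f₂ r) (σ.f₁ a) * (G.π₁Act x y : G.G₂))
        (mk_f₁_of_comp_toπ₁ hσ a).symm)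

theorem kerProd_bd_eq_one_iff (β : (kerProd G q).G₂) : (kerProd G q).bd β = 1 ↔ β.1 = 1 :=
  ⟨fun h => Subtype.ext h, fun h => congrArg Subtype.val h⟩

theorem mem_range_kerProd_bd (a : A) : a ∈ (kerProd G q).bd.range ↔ q a = 1 := by
  constructor
  · rintro ⟨β, rfl⟩
    exact β.1.2
  · exact fun h => ⟨(⟨a, h⟩, 1), rfl⟩

/-- The source has boundary image `ker q` and boundary kernel `1 × π₂ G`. On `π₁` the map is the
isomorphism induced by `q`, because `σ` lies over `q`; on `π₂` it is `(1, x) ↦ x`. -/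
theorem equivalences_kerProdDesc (hq : Function.Surjective q) (σ : ofKer q ⟶ G)
    (hσ : σ ≫ G.toπ₁ = ofKerMap q) : equivalences (kerProdDesc σ hσ) := by
  refine ⟨⟨?_, ?_⟩, ⟨?_, ?_⟩⟩
  · rw [injective_iff_map_eq_one]
    intro x
    induction x using QuotientGroup.induction_on with | H a => ?_
    intro h
    exact (QuotientGroup.eq_one_iff (N := (kerProd G q).bd.range) a).2
      ((mem_range_kerProd_bd a).2 <| (mk_f₁_of_comp_toπ₁ hσ a).symm.trans h)
  · intro y
    obtain ⟨a, rfl⟩ := hq y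
    exact ⟨QuotientGroup.mk' (kerProd G q).bd.range a, mk_f₁_of_comp_toπ₁ hσ a⟩
  · rw [injective_iff_map_eq_one]
    rintro ⟨⟨r, x⟩, hr⟩ h
    obtain rfl : r = 1 := (kerProd_bd_eq_one_iff (r, x)).1 hr
    have h' : σ.f₂ 1 * (x : G.G₂) = 1 := congrArg Subtype.val h
    rw [map_one, one_mul] at h'
    obtain rfl : x = 1 := Subtype.ext h'
    rfl
  · intro x
    refine ⟨⟨(1, x), (kerProd_bd_eq_one_iff (1, x)).2 rfl⟩, Subtype.ext ?_⟩
    change σ.f₂ 1 * (x : G.G₂) = x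
    rw [map_one, one_mul]

theorem equivalences_kerProdToTrivialModel (hq : Function.Surjective q) :
    equivalences (kerProdToTrivialModel G q) := by
  refine ⟨⟨?_, ?_⟩, ⟨?_, ?_⟩⟩
  · rw [injective_iff_map_eq_one]
    intro x
    induction x using QuotientGroup.induction_on with | H a => ?_
    intro h
    obtain ⟨β, hβ⟩ := (QuotientGroup.eq_one_iff (N := G.trivialModel.bd.range) (q a)).1 h
    exact (QuotientGroup.eq_one_iff (N := (kerProd G q).bd.range) a).2
      ((mem_range_kerProd_bd a).2 hβ.symm)
  · intro y
    induction y using QuotientGroup.induction_on with | H y => ?_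
    obtain ⟨a, rfl⟩ := hq y
    exact ⟨QuotientGroup.mk' (kerProd G q).bd.range a, rfl⟩
  · rw [injective_iff_map_eq_one]
    rintro ⟨⟨r, x⟩, hr⟩ h
    obtain rfl : r = 1 := (kerProd_bd_eq_one_iff (r, x)).1 hr
    obtain rfl : x = 1 := congrArg Subtype.val h
    rfl
  · intro x
    exact ⟨⟨(1, x.1), (kerProd_bd_eq_one_iff (1, x.1)).2 rfl⟩, rfl⟩

/-- An equivalence becomes an isomorphism in the homotopy category. -/
noncomputable def isoOfEquivalences {X Y : XMod.{u}} {w : X ⟶ Y} (hw : equivalences w) :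
    toHo.obj X ≅ toHo.obj Y :=
  Localization.isoOfHom toHo equivalences w hw

theorem isSplit_of_strict_lift (hq : Function.Surjective q) (σ : ofKer q ⟶ G)
    (hσ : σ ≫ G.toπ₁ = ofKerMap q) : G.IsSplit :=
  ⟨(isoOfEquivalences (equivalences_kerProdDesc hq σ hσ)).symm ≪≫
    isoOfEquivalences (equivalences_kerProdToTrivialModel hq)⟩

end Splitting

end XMod

theorem proposition13p7 (G : XMod.{u})
    (hsection : ∃ s : XMod.toHo.obj (XMod.ofGroup G.π₁) ⟶ XMod.toHo.obj G,
      s ≫ XMod.toHo.map G.toπ₁ = 𝟙 (XMod.toHo.obj (XMod.ofGroup G.π₁))) :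
    G.IsSplit := by
  obtain ⟨s, hs⟩ := hsection
  -- The tautological free presentation, with every element of `π₁ G` as a generator.
  let q : FreeGroup G.π₁ →* G.π₁ := FreeGroup.lift id
  have : IsFreeGroup (XMod.ofKer q).G₁ := inferInstanceAs (IsFreeGroup (FreeGroup G.π₁))
  obtain ⟨σ, hσ⟩ := XMod.exists_strict_lift (XMod.ofKerMap q) G.toπ₁ s hs
  exact XMod.isSplit_of_strict_lift (fun x => ⟨FreeGroup.of x, by simp [q]⟩) σ hσ
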